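/- Monoids are commutative and cancellative with an identity, and are written additively. An affine monoid is a finitely generated torsion-free monoid $S$ (torsion-free: $nx=ny$ with $n\ge 1$ implies $x=y$). An ideal of $S$ is a subset $I\subseteq S$ with $S+I\subseteq I$; it is prime if $I\neq S$ and $a+b\in I$ implies $a\in I$ or $b\in I$ (so $\emptyset$ is prime). Let $\mathfrak X(S)$ be the set of minimal non-empty prime ideals of $S$, let $\mathsf q(S)$ be the quotient group of $S$, and for a prime ideal $P$ put $S_P=\{a-s\mid a\in S,\ s\in S\setminus P\}\subseteq \mathsf q(S)$. The monoid $S$ is called weakly Krull if $S=\bigcap_{P\in\mathfrak X(S)}S_P$ and every non-unit of $S$ lies in only finitely many $P\in\mathfrak X(S)$. For a domain $D$ let $\mathfrak X(D)$ be the set of prime ideals of height one; $D$ is called weakly Krull if $D=\bigcap_{P\in\mathfrak X(D)}D_P$ and every non-zero non-unit of $D$ lies in only finitely many $P\in\mathfrak X(D)$. (Intersections are taken in $\mathsf q(S)$, respectively in the quotient field of $D$; an empty intersection is the whole of $\mathsf q(S)$, respectively of the quotient field.) **Corollary 2.15.** Let $K$ be a field and let $S$ be an affine monoid. Then the monoid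 algebra $K[S]$ (which is a domain) is weakly Krull if and only if $S$ is weakly Krull. -/

import Mathlib

open Algebra

/-! ### Weakly Krull domains -/

section Domain

variable (D : Type*) [CommRing D] [IsDomain D]

/-- The height-one spectrum of a domain: the prime ideals of height one. -/
def heightOneSpectrum : Set (PrimeSpectrum D) :=
  {P | P.asIdeal.height = 1}

/-- The localization `D_P`, as a `D`-subalgebra of the quotient field of `D`: its elements are the
fractions `a / s` with `a ∈ D` and `s ∈ D \ P`. -/
noncomputable def domainLocalizationAt (P : PrimeSpectrum D) : Subalgebra D (FractionRing D) :=
  Localization.subalgebra.ofField (FractionRing D) P.asIdeal.primeCompl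
    P.asIdeal.primeCompl_le_nonZeroDivisors

/-- A domain `D` is weakly Krull if it is the intersection, inside its quotient field, of its
localizations at the primes of height one (the empty intersection being the quotient field), and
every non-zero non-unit lies in only finitely many primes of height one. -/
structure IsWeaklyKrullDomain : Prop where
  /-- `⊥` is the image of `D` in its quotient field. -/
  iInf_localization_eq : ⨅ P ∈ heightOneSpectrum D, domainLocalizationAt D P = ⊥
  finite_character : ∀ x : D, x ≠ 0 → ¬ IsUnit x →
    {P ∈ heightOneSpectrum D | x ∈ P.asIdeal}.Finite

end Domain

/-! ### Weakly Krull monoids (written additively) -/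

section Monoid

variable {S : Type*} [AddCancelCommMonoid S]

/-- A prime ideal of a monoid: a proper ideal `P` such that `a + b ∈ P` implies `a ∈ P` or `b ∈ P`.
The empty ideal is prime. -/
structure IsPrimeMonoidIdeal (P : AddSemigroupIdeal S) : Prop where
  ne_univ : (P : Set S) ≠ Set.univ
  mem_or_mem : ∀ {a b : S}, a + b ∈ P → a ∈ P ∨ b ∈ P

/-- The complement of a prime ideal of a monoid, as a submonoid. -/
def IsPrimeMonoidIdeal.primeCompl {P : AddSemigroupIdeal S} (hP : IsPrimeMonoidIdeal P) :
    AddSubmonoid S where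
  carrier := {s | s ∉ P}
  zero_mem' := fun h0 => hP.ne_univ <| Set.eq_univ_of_forall fun x => by
    simpa using AddSemigroupIdeal.add_mem P x h0
  add_mem' := fun ha hb hab => (hP.mem_or_mem hab).elim ha hb

/-- The localization `S_P`, as a submonoid of the quotient group of `S`: its elements are the
differences `a - s` with `a ∈ S` and `s ∈ S \ P`. -/
def monoidLocalizationAt {P : AddSemigroupIdeal S} (hP : IsPrimeMonoidIdeal P) :
    AddSubmonoid (GrothendieckAddGroup S) where
  carrier := {x | ∃ a : S, ∃ s ∈ hP.primeCompl,
    x = GrothendieckAddGroup.of a - GrothendieckAddGroup.of s}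
  zero_mem' := ⟨0, 0, zero_mem _, by simp⟩
  add_mem' := by
    rintro _ _ ⟨a, s, hs, rfl⟩ ⟨b, t, ht, rfl⟩
    exact ⟨a + b, s + t, add_mem hs ht, by rw [map_add, map_add, add_sub_add_comm]⟩

variable (S)

/-- The minimal non-empty prime ideals ("height-one primes") of a monoid. -/
def minimalNonemptyPrimes : Set (AddSemigroupIdeal S) :=
  {P | Minimal (fun Q : AddSemigroupIdeal S => IsPrimeMonoidIdeal Q ∧ (Q : Set S).Nonempty) P}

variable {S} in
theorem minimalNonemptyPrimes.isPrime {P : AddSemigroupIdeal S}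
    (hP : P ∈ minimalNonemptyPrimes S) : IsPrimeMonoidIdeal P :=
  (Minimal.prop (Set.mem_ofPred_eq ▸ hP)).1

/-- A monoid `S` is weakly Krull if it is the intersection, inside its quotient group, of its
localizations at its minimal non-empty prime ideals (the empty intersection being the quotient
group), and every non-unit lies in only finitely many minimal non-empty prime ideals. -/
structure IsWeaklyKrullMonoid : Prop where
  /-- The range of `of` is the image of `S` in its quotient group. -/
  iInf_localization_eq :
    ⨅ (P : AddSemigroupIdeal S) (hP : P ∈ minimalNonemptyPrimes S),
      monoidLocalizationAt (minimalNonemptyPrimes.isPrime hP) =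
    AddMonoidHom.mrange (GrothendieckAddGroup.of : S →+ GrothendieckAddGroup S)
  finite_character : ∀ a : S, ¬ IsAddUnit a →
    {P ∈ minimalNonemptyPrimes S | a ∈ P}.Finite

end Monoid

/-! Finite character is automatic on both sides: `K[S]` is Noetherian and `S` has only finitely many
primes. So only the two intersections matter. The height-one primes of `K[S]` containing a monomial
are exactly the `K[P]` with `P` a minimal non-empty prime of `S` (`height_monomialIdeal`,
`exponentIdeal_mem_minimalNonemptyPrimes`). If `K[S]` is weakly Krull and `a - b` lies in every
`S_P`, then `x^a / x^b` lies in every `K[S]_Q`: either `Q` is some `K[P]`, or `x^b ∉ Q`. Hence `x^b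
∣ x^a`, and `a - b ∈ S`. Conversely, a fraction lying in every `K[S]_Q` lies in `K[q(S)]`, a
factorial localization of `K[S]`. Its support lies in `S_P` for each `P`
(`exists_add_eq_of_mem_support`, the main technical step), hence in `S`. -/

namespace AddMonoidAlgebra

/-! ### Inverting monomials and factoriality -/

/-- If every element of the group `G` is a difference of elements of the submonoid `φ(M)`, then
`K[G]` is the localization of `K[M]` at its monomials. -/
theorem isLocalization_mapDomainRingHom {K M G : Type*} [Field K] [AddCommMonoid M]
    [AddCommGroup G] (φ : M →+ G) (hφ : Function.Injective φ)
    (hsurj : ∀ g, ∃ a b, g = φ a - φ b) :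
    letI := (mapDomainRingHom K φ).toAlgebra
    IsLocalization (MonoidHom.mrange (of K M)) (AddMonoidAlgebra K G) := by
  let := (mapDomainRingHom K φ).toAlgebra
  have hmap : ∀ x, algebraMap (AddMonoidAlgebra K M) (AddMonoidAlgebra K G) x =
    mapDomain φ x := fun x => rfl
  refine ⟨?_, ?_, ?_⟩
  · rintro ⟨_, m, rfl⟩
    refine IsUnit.of_mul_eq_one (single (-φ m.toAdd) 1) ?_
    simp [hmap, single_mul_single, one_def]
  · intro z
    induction z using induction_on with
    | of g =>
      obtain ⟨a, b, rfl⟩ := hsurj g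
      refine ⟨(single a 1, ⟨of K M (.ofAdd b), _, rfl⟩), ?_⟩
      simp [hmap, single_mul_single]
    | add x y hx hy =>
      obtain ⟨⟨p, s⟩, hp⟩ := hx
      obtain ⟨⟨q, t⟩, hq⟩ := hy
      refine ⟨(p * t + q * s, s * t), ?_⟩
      simp only [Submonoid.coe_mul, map_mul, map_add] at hp hq ⊢
      rw [← hp, ← hq]
      ring
    | smul r x hx =>
      obtain ⟨⟨p, s⟩, hp⟩ := hx
      refine ⟨(r • p, s), ?_⟩
      have : algebraMap (AddMonoidAlgebra K M) (AddMonoidAlgebra K G) (r • p) =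
          r • algebraMap (AddMonoidAlgebra K M) (AddMonoidAlgebra K G) p := by
        ext; simp [hmap]
      simp only [smul_mul_assoc, this] at hp ⊢
      rw [hp]
  · intro x y hxy
    exact ⟨1, by rw [mapDomain_injective hφ hxy]⟩

/-- Laurent polynomial rings over a field are factorial. -/
theorem uniqueFactorizationMonoid_of_addCommGroup (K G : Type*) [Field K] [AddCommGroup G]
    [IsAddTorsionFree G] [AddMonoid.FG G] :
    UniqueFactorizationMonoid (AddMonoidAlgebra K G) := by
  have : AddGroup.FG G := AddGroup.fg_iff_addMonoid_fg.2 ‹_›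
  let b := Module.finBasis ℤ G
  let φ : (Fin (Module.finrank ℤ G) →₀ ℕ) →+ G :=
    b.repr.symm.toAddMonoidHom.comp (Finsupp.mapRange.addMonoidHom (Nat.castAddMonoidHom ℤ))
  have hφ : Function.Injective φ := b.repr.symm.injective.comp
    (Finsupp.mapRange_injective _ (by simp) Nat.cast_injective)
  have hsurj : ∀ g, ∃ a c, g = φ a - φ c := fun g => by
    -- Positive and negative parts of the integer coordinates of `g`.
    refine ⟨(b.repr g).mapRange Int.toNat rfl, (b.repr (-g)).mapRange Int.toNat rfl, ?_⟩
    apply b.repr.injective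
    ext i
    simp [φ]
  let := (mapDomainRingHom K φ).toAlgebra
  have := isLocalization_mapDomainRingHom (K := K) φ hφ hsurj
  have : UniqueFactorizationMonoid (AddMonoidAlgebra K (Fin (Module.finrank ℤ G) →₀ ℕ)) :=
    inferInstanceAs (UniqueFactorizationMonoid (MvPolynomial _ K))
  exact .of_isLocalization (MonoidHom.mrange (of K (Fin (Module.finrank ℤ G) →₀ ℕ))) _

theorem isNoetherianRing_of_fg (K M : Type*) [Field K] [AddCommMonoid M] [AddMonoid.FG M] :
    IsNoetherianRing (AddMonoidAlgebra K M) :=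
  Algebra.FiniteType.isNoetherianRing K _

end AddMonoidAlgebra

/-! ### Height-one primes of domains -/

theorem Ideal.IsPrime.eq_of_le_of_height_eq_one {D : Type*} [CommRing D] [IsDomain D]
    {P Q : Ideal D} (hQ : Q.IsPrime) (hQ0 : Q ≠ ⊥) (hP : P.height = 1) (h : Q ≤ P) : Q = P := by
  have hle : Q.height ≤ 1 := hP ▸ Ideal.height_mono h
  have : Q.FiniteHeight := ⟨.inr fun h => by simp [h] at hle⟩
  refine Ideal.eq_of_le_of_height_le _ h ?_
  rw [hP, Order.one_le_iff_pos, pos_iff_ne_zero]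
  simpa [Ideal.height_eq_zero_iff_eq_bot] using hQ0

theorem Ideal.IsPrime.height_eq_one_of_mem_minimalPrimes {D : Type*} [CommRing D] [IsDomain D]
    [IsNoetherianRing D] {P : Ideal D} {x : D} (hx : x ≠ 0)
    (hP : P ∈ (Ideal.span {x}).minimalPrimes) : P.height = 1 := by
  refine le_antisymm (Ideal.height_le_one_of_isPrincipal_of_mem_minimalPrimes _ _ hP) ?_
  rw [Order.one_le_iff_pos, pos_iff_ne_zero, Ne, Ideal.height_eq_zero_iff_eq_bot]
  rintro rfl
  exact hx (by simpa using hP.1.2)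

/-- Let `R` be a factorial localization of a domain `D`. A fraction `p / q` lying in `D_Q` for all
primes `Q` of height one lies in `R`. -/
theorem IsLocalization.algebraMap_dvd_of_forall_height_eq_one {D R : Type*} [CommRing D]
    [IsDomain D] [CommRing R] [IsDomain R] [IsNoetherianRing R] [UniqueFactorizationMonoid R]
    [Algebra D R] (W : Submonoid D) [IsLocalization W R]
    (hinj : Function.Injective (algebraMap D R)) {p q : D} (hq : q ≠ 0)
    (h : ∀ Q ∈ heightOneSpectrum D, ∃ a, ∃ s ∉ Q.asIdeal, p * s = a * q) :
    algebraMap D R q ∣ algebraMap D R p := by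
  obtain ⟨p', q', c, hrel, hp, hq'⟩ := UniqueFactorizationMonoid.exists_reduced_factors'
    (algebraMap D R p) (algebraMap D R q) ((map_ne_zero_iff _ hinj).2 hq)
  have hq0 : algebraMap D R q ≠ 0 := (map_ne_zero_iff _ hinj).2 hq
  have hc : c ≠ 0 := by rintro rfl; simp [← hq'] at hq0
  have hq'0 : q' ≠ 0 := by rintro rfl; simp [← hq'] at hq0
  by_cases hu : IsUnit q'
  · rw [← hp, ← hq']
    exact mul_dvd_mul_left c hu.dvd
  -- A prime factor `π` of the reduced denominator contracts to a height-one prime of `D`. There `h`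
  -- provides a denominator prime to `π`, which forces `π ∣ p'`, against coprimality.
  obtain ⟨π, hπ, hπq⟩ := WfDvdMonoid.exists_irreducible_factor hu hq'0
  have hπ' := hπ.prime
  have hprime : (Ideal.span {π}).IsPrime := (Ideal.span_singleton_prime hπ'.ne_zero).2 hπ'
  have hht : (Ideal.span {π}).height = 1 :=
    Ideal.IsPrime.height_eq_one_of_mem_minimalPrimes hπ'.ne_zero
      (by rw [Ideal.minimalPrimes_eq_subsingleton_self]; rfl)
  obtain ⟨a, s, hs, e⟩ := h ⟨(Ideal.span {π}).under D, inferInstance⟩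
    (by simpa [heightOneSpectrum, IsLocalization.height_under W] using hht)
  have e' : p' * algebraMap D R s = algebraMap D R a * q' := by
    apply mul_left_cancel₀ hc
    have := congrArg (algebraMap D R) e
    rw [map_mul, map_mul, ← hp, ← hq'] at this
    linear_combination this
  have hs' : ¬ π ∣ algebraMap D R s := by
    simpa [Ideal.under, Ideal.mem_comap, Ideal.mem_span_singleton] using hs
  have hπp : π ∣ p' :=
    (hπ'.dvd_or_dvd (e' ▸ hπq.mul_left _ : π ∣ p' * algebraMap D R s)).resolve_right hs'
  exact absurd (hrel hπp hπq) hπ.not_isUnit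

/-- A domain is the intersection of its localizations at height-one primes iff divisibility can be
tested locally at these primes. -/
theorem iInf_domainLocalizationAt_eq_bot_iff (D : Type*) [CommRing D] [IsDomain D] :
    ⨅ P ∈ heightOneSpectrum D, domainLocalizationAt D P = ⊥ ↔
      ∀ p q : D, q ≠ 0 →
        (∀ Q ∈ heightOneSpectrum D, ∃ a, ∃ s ∉ Q.asIdeal, p * s = a * q) → q ∣ p := by
  have hmem : ∀ (Q : PrimeSpectrum D) (p q : D), q ≠ 0 →
      (algebraMap D (FractionRing D) p / algebraMap D (FractionRing D) q ∈
        domainLocalizationAt D Q ↔ ∃ a, ∃ s ∉ Q.asIdeal, p * s = a * q) := by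
    intro Q p q hq
    have hq' : algebraMap D (FractionRing D) q ≠ 0 := by simpa using hq
    change (∃ (a s : D) (_ : s ∈ Q.asIdeal.primeCompl), _ = _) ↔ _
    refine exists_congr fun a => exists_congr fun s => ?_
    rw [exists_prop]
    refine and_congr_right fun hs => ?_
    have hs' : algebraMap D (FractionRing D) s ≠ 0 := by
      have : s ≠ 0 := by rintro rfl; exact hs Q.asIdeal.zero_mem
      simpa using this
    rw [← div_eq_mul_inv, div_eq_div_iff hq' hs', ← map_mul, ← map_mul,
      (IsFractionRing.injective D (FractionRing D)).eq_iff]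
  have hbot : ∀ p q : D, q ≠ 0 →
      (algebraMap D (FractionRing D) p / algebraMap D (FractionRing D) q ∈
        (⊥ : Subalgebra D (FractionRing D)) ↔ q ∣ p) := by
    intro p q hq
    have hq' : algebraMap D (FractionRing D) q ≠ 0 := by simpa using hq
    rw [Algebra.mem_bot]
    refine exists_congr fun c => ?_
    rw [eq_div_iff hq', ← map_mul, (IsFractionRing.injective D (FractionRing D)).eq_iff,
      eq_comm, mul_comm]
  constructor
  · intro h p q hq hloc
    rw [← hbot p q hq, ← h]
    simp only [Algebra.mem_iInf]
    exact fun Q hQ => (hmem Q p q hq).2 (hloc Q hQ)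
  · intro h
    refine le_antisymm (fun x hx => ?_) bot_le
    obtain ⟨p, q, hq, rfl⟩ := IsFractionRing.div_surjective (A := D) x
    have hq := nonZeroDivisors.ne_zero hq
    refine (hbot p q hq).2 (h p q hq fun Q hQ => (hmem Q p q hq).1 ?_)
    simp only [Algebra.mem_iInf] at hx
    exact hx Q hQ

/-- In a Noetherian domain every nonzero element lies in finitely many primes of height one. -/
theorem finite_heightOneSpectrum_mem (D : Type*) [CommRing D] [IsDomain D] [IsNoetherianRing D]
    {x : D} (hx : x ≠ 0) : {P ∈ heightOneSpectrum D | x ∈ P.asIdeal}.Finite := by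
  refine Set.Finite.of_finite_image (f := PrimeSpectrum.asIdeal)
    ((Ideal.finite_minimalPrimes_of_isNoetherianRing D (Ideal.span {x})).subset ?_)
    (fun P _ Q _ h => PrimeSpectrum.ext h)
  rintro _ ⟨P, ⟨hP, hxP⟩, rfl⟩
  refine ⟨⟨P.2, by simpa [Ideal.span_le] using hxP⟩, fun Q ⟨hQ, hxQ⟩ hle => ?_⟩
  refine (hQ.eq_of_le_of_height_eq_one ?_ hP hle).ge
  rintro rfl
  exact hx (by simpa using hxQ)

/-! ### Prime ideals of monoids -/

section MonoidPrimes

variable {S : Type*} [AddCancelCommMonoid S]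

theorem IsPrimeMonoidIdeal.zero_notMem {P : AddSemigroupIdeal S} (hP : IsPrimeMonoidIdeal P) :
    (0 : S) ∉ P :=
  hP.primeCompl.zero_mem

theorem IsPrimeMonoidIdeal.add_mem_iff {P : AddSemigroupIdeal S} (hP : IsPrimeMonoidIdeal P)
    {a b : S} : a + b ∈ P ↔ a ∈ P ∨ b ∈ P :=
  ⟨hP.mem_or_mem, fun h => h.elim (fun h => add_comm b a ▸ AddSemigroupIdeal.add_mem P b h)
    fun h => AddSemigroupIdeal.add_mem P a h⟩

theorem minimalNonemptyPrimes.nonempty {P : AddSemigroupIdeal S}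
    (hP : P ∈ minimalNonemptyPrimes S) : (P : Set S).Nonempty :=
  (Minimal.prop (Set.mem_ofPred_eq ▸ hP)).2

theorem minimalNonemptyPrimes.le_of_le {P Q : AddSemigroupIdeal S}
    (hP : P ∈ minimalNonemptyPrimes S) (hQ : IsPrimeMonoidIdeal Q) (hne : (Q : Set S).Nonempty)
    (hle : Q ≤ P) : P ≤ Q :=
  Minimal.le_of_le (Set.mem_ofPred_eq ▸ hP) ⟨hQ, hne⟩ hle

/-- A finitely generated monoid has only finitely many prime ideals. -/
theorem finite_setOf_isPrimeMonoidIdeal (S : Type*) [AddCancelCommMonoid S] [AddMonoid.FG S] :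
    {P : AddSemigroupIdeal S | IsPrimeMonoidIdeal P}.Finite := by
  obtain ⟨X, hX⟩ := AddMonoid.FG.fg_top (M := S)
  refine Set.Finite.of_finite_image (f := fun P => (X : Set S) ∩ P)
    (X.finite_toSet.finite_subsets.subset ?_) ?_
  · rintro _ ⟨P, -, rfl⟩
    exact Set.inter_subset_left
  -- A prime is determined by the generators it contains, since a sum lies in it iff some summand
  -- does.
  · intro P hP Q hQ h
    ext x
    have hx : x ∈ AddSubmonoid.closure (X : Set S) := hX ▸ AddSubmonoid.mem_top x
    induction hx using AddSubmonoid.closure_induction with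
    | mem x hx => simpa [hx] using Set.ext_iff.1 h x
    | zero => simp [hP.zero_notMem, hQ.zero_notMem]
    | add x y _ _ hx hy => exact hP.add_mem_iff.trans ((or_congr hx hy).trans hQ.add_mem_iff.symm)

/-- A minimal non-empty prime ideal is contained in the radical of every principal ideal, locally at
that prime. -/
theorem exists_nsmul_add_eq_of_mem_minimalNonemptyPrimes {P : AddSemigroupIdeal S}
    (hP : P ∈ minimalNonemptyPrimes S) (a : S) {m : S} (hm : m ∈ P) :
    ∃ (n : ℕ) (t y : S), t ∉ P ∧ n • m + t = a + y := by
  by_contra! hcon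
  have hPp := minimalNonemptyPrimes.isPrime hP
  -- The complement of `P'` is the divisor-closed submonoid generated by `m` and `S \ P`. If the
  -- claim fails, `a ∈ P'`, so `P'` is a non-empty prime inside `P` that misses `m`, contradicting
  -- minimality.
  let P' : AddSemigroupIdeal S :=
    { carrier := {x | ∀ (n : ℕ) (t y : S), t ∉ P → n • m + t ≠ x + y}
      vadd_mem' := fun c x hx n t y ht h => hx n t (c + y) ht <| by
        rw [h, vadd_eq_add]; abel }
  have hmem : ∀ x, x ∈ P' ↔ ∀ (n : ℕ) (t y : S), t ∉ P → n • m + t ≠ x + y := fun x => Iff.rfl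
  have hP' : IsPrimeMonoidIdeal P' := by
    refine ⟨fun h => ?_, fun {x x'} hx => ?_⟩
    · exact (hmem 0).1 (h ▸ Set.mem_univ (0 : S) : (0 : S) ∈ (P' : Set S)) 0 0 0 hPp.zero_notMem
        (by simp)
    · by_contra! h
      simp only [hmem] at h
      push Not at h
      obtain ⟨⟨n, t, y, ht, e⟩, ⟨n', t', y', ht', e'⟩⟩ := h
      refine (hmem _).1 hx (n + n') (t + t') (y + y') ?_ ?_
      · rw [hPp.add_mem_iff]; tauto
      · calc (n + n') • m + (t + t') = (n • m + t) + (n' • m + t') := by rw [add_nsmul]; abel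
          _ = x + x' + (y + y') := by rw [e, e']; abel
  have hle : P' ≤ P := fun x hx => by
    by_contra h
    exact (hmem x).1 hx 0 x 0 h (by simp)
  have hPP' : P ≤ P' := minimalNonemptyPrimes.le_of_le hP hP' ⟨a, hcon⟩ hle
  exact (hmem m).1 (hPP' hm) 1 0 0 hPp.zero_notMem (by simp)

/-- A monoid is the intersection of its localizations at minimal non-empty primes iff membership
can be tested locally at these primes. -/
theorem iInf_monoidLocalizationAt_eq_mrange_iff :
    ⨅ (P : AddSemigroupIdeal S) (hP : P ∈ minimalNonemptyPrimes S),
        monoidLocalizationAt (minimalNonemptyPrimes.isPrime hP) =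
      AddMonoidHom.mrange (GrothendieckAddGroup.of : S →+ GrothendieckAddGroup S) ↔
    ∀ g : GrothendieckAddGroup S, (∀ P ∈ minimalNonemptyPrimes S, ∃ a, ∃ s ∉ P,
      g + GrothendieckAddGroup.of s = GrothendieckAddGroup.of a) →
        ∃ x, GrothendieckAddGroup.of x = g := by
  have hmem : ∀ {P : AddSemigroupIdeal S} (hP : IsPrimeMonoidIdeal P) (g : GrothendieckAddGroup S),
      g ∈ monoidLocalizationAt hP ↔
        ∃ a, ∃ s ∉ P, g + GrothendieckAddGroup.of s = GrothendieckAddGroup.of a := by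
    intro P hP g
    refine exists_congr fun a => exists_congr fun s => and_congr_right fun _ => ?_
    exact eq_sub_iff_add_eq
  constructor
  · intro h g hg
    rw [← AddMonoidHom.mem_mrange, ← h]
    simp only [AddSubmonoid.mem_iInf]
    exact fun P hP => (hmem _ g).2 (hg P hP)
  · intro h
    apply le_antisymm
    · intro g hg
      simp only [AddSubmonoid.mem_iInf] at hg
      exact h g fun P hP => (hmem _ g).1 (hg P hP)
    · rintro _ ⟨x, rfl⟩
      simp only [AddSubmonoid.mem_iInf]
      exact fun P hP => (hmem _ _).2
        ⟨x, 0, (minimalNonemptyPrimes.isPrime hP).zero_notMem, by simp⟩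

theorem Algebra.GrothendieckAddGroup.exists_eq_of_sub_of (g : GrothendieckAddGroup S) :
    ∃ a b : S, g = GrothendieckAddGroup.of a - GrothendieckAddGroup.of b := by
  obtain ⟨⟨a, b⟩, h⟩ := (AddLocalization.addMonoidOf (⊤ : AddSubmonoid S)).surj g
  exact ⟨a, b, eq_sub_of_add_eq h⟩

end MonoidPrimes

/-! ### Monomial ideals and exponents -/

namespace AddMonoidAlgebra

theorem exists_mem_support_add_of_mem_support_mul {K M : Type*} [Semiring K] [Add M]
    {x y : AddMonoidAlgebra K M} {m : M} (hm : m ∈ (x * y).coeff.support) :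
    ∃ a ∈ x.coeff.support, ∃ b ∈ y.coeff.support, a + b = m := by
  classical
  exact Finset.mem_add.1 (support_coeff_mul_subset x y hm)

theorem exists_mem_support_of_mem_support_mapDomain {K M N : Type*} [Semiring K] {φ : M → N}
    {x : AddMonoidAlgebra K M} {n : N} (hn : n ∈ (mapDomain φ x).coeff.support) :
    ∃ m ∈ x.coeff.support, φ m = n := by
  classical
  rw [coeff_mapDomain] at hn
  simpa using Finsupp.mapDomain_support hn

section MonomialIdeal

variable (K : Type*) {S : Type*} [Field K] [AddCancelCommMonoid S]

/-- The ideal `K[P]` of `K[S]` spanned by the monomials with exponent in `P`. -/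
noncomputable def monomialIdeal (P : AddSemigroupIdeal S) : Ideal (AddMonoidAlgebra K S) :=
  Ideal.span (of' K S '' P)

variable {K}

theorem mem_monomialIdeal {P : AddSemigroupIdeal S} {f : AddMonoidAlgebra K S} :
    f ∈ monomialIdeal K P ↔ ∀ m ∈ f.coeff.support, m ∈ P := by
  rw [monomialIdeal, mem_ideal_span_of'_image]
  refine forall₂_congr fun m _ => ⟨?_, fun h => ⟨m, h, 0, by simp⟩⟩
  rintro ⟨m', hm', d, rfl⟩
  exact AddSemigroupIdeal.add_mem P d hm'

theorem single_mem_monomialIdeal {P : AddSemigroupIdeal S} {m : S} :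
    single m (1 : K) ∈ monomialIdeal K P ↔ m ∈ P := by
  simp [mem_monomialIdeal]

theorem monomialIdeal_le_iff {P : AddSemigroupIdeal S} {I : Ideal (AddMonoidAlgebra K S)} :
    monomialIdeal K P ≤ I ↔ ∀ m ∈ P, single m (1 : K) ∈ I := by
  rw [monomialIdeal, Ideal.span_le, Set.image_subset_iff]
  rfl

theorem monomialIdeal_ne_bot {P : AddSemigroupIdeal S} (hP : (P : Set S).Nonempty) :
    monomialIdeal K P ≠ ⊥ := by
  obtain ⟨a, ha⟩ := hP
  intro h
  have := (single_mem_monomialIdeal (K := K)).2 ha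
  simp [h] at this

open Classical in
/-- The terms of `f` whose exponent lies outside of `P`. -/
noncomputable def termsOutside (P : AddSemigroupIdeal S) (f : AddMonoidAlgebra K S) :
    AddMonoidAlgebra K S :=
  ofCoeff (f.coeff.filter (· ∉ P))

theorem notMem_of_mem_support_termsOutside {P : AddSemigroupIdeal S} {f : AddMonoidAlgebra K S}
    {m : S} (hm : m ∈ (termsOutside P f).coeff.support) : m ∉ P := by
  classical
  rw [termsOutside, coeff_ofCoeff, Finsupp.support_filter, Finset.mem_filter] at hm
  exact hm.2

theorem sub_termsOutside_mem {P : AddSemigroupIdeal S} (f : AddMonoidAlgebra K S) :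
    f - termsOutside P f ∈ monomialIdeal K P := by
  classical
  rw [mem_monomialIdeal]
  intro m hm
  by_contra h
  simp [termsOutside, h] at hm

theorem eq_zero_of_mem_monomialIdeal {P : AddSemigroupIdeal S} {f : AddMonoidAlgebra K S}
    (hf : f ∈ monomialIdeal K P) (h : ∀ m ∈ f.coeff.support, m ∉ P) : f = 0 := by
  rw [← coeff_eq_zero, ← Finsupp.support_eq_empty, Finset.eq_empty_iff_forall_notMem]
  exact fun m hm => h m hm (mem_monomialIdeal.1 hf m hm)

theorem notMem_of_mem_support_mul {P : AddSemigroupIdeal S} (hP : IsPrimeMonoidIdeal P)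
    {f g : AddMonoidAlgebra K S} (hf : ∀ m ∈ f.coeff.support, m ∉ P)
    (hg : ∀ m ∈ g.coeff.support, m ∉ P) : ∀ m ∈ (f * g).coeff.support, m ∉ P := by
  intro m hm
  obtain ⟨a, ha, b, hb, rfl⟩ := exists_mem_support_add_of_mem_support_mul hm
  exact fun h => (hP.mem_or_mem h).elim (hf a ha) (hg b hb)

theorem notMem_of_mem_support_pow {P : AddSemigroupIdeal S} (hP : IsPrimeMonoidIdeal P)
    {f : AddMonoidAlgebra K S} (hf : ∀ m ∈ f.coeff.support, m ∉ P) (n : ℕ) :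
    ∀ m ∈ (f ^ n).coeff.support, m ∉ P := by
  induction n with
  | zero =>
    intro m hm
    have : m = 0 := by simpa using hm
    exact this ▸ hP.zero_notMem
  | succ n ih => exact pow_succ f n ▸ notMem_of_mem_support_mul hP ih hf

/-- The exponents of the monomials in an ideal of `K[S]`. -/
def exponentIdeal (Q : Ideal (AddMonoidAlgebra K S)) : AddSemigroupIdeal S where
  carrier := {m | single m (1 : K) ∈ Q}
  vadd_mem' c m hm := by
    have := Q.mul_mem_left (single c 1) hm
    rwa [single_mul_single, one_mul] at this

theorem mem_exponentIdeal {Q : Ideal (AddMonoidAlgebra K S)} {m : S} :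
    m ∈ exponentIdeal Q ↔ single m (1 : K) ∈ Q := Iff.rfl

theorem isPrimeMonoidIdeal_exponentIdeal {Q : Ideal (AddMonoidAlgebra K S)} (hQ : Q.IsPrime) :
    IsPrimeMonoidIdeal (exponentIdeal Q) where
  ne_univ h := hQ.ne_top <| Q.eq_top_iff_one.2 <|
    (h ▸ Set.mem_univ (0 : S) : (0 : S) ∈ (exponentIdeal Q : Set S))
  mem_or_mem {a b} h := hQ.mem_or_mem <| by
    rwa [single_mul_single, one_mul]

theorem monomialIdeal_exponentIdeal_le (Q : Ideal (AddMonoidAlgebra K S)) :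
    monomialIdeal K (exponentIdeal Q) ≤ Q :=
  monomialIdeal_le_iff.2 fun _ h => h

variable [IsAddTorsionFree S] [AddMonoid.FG S]

/-- Modulo `K[P]` each element is represented by its terms outside `P`. A product of such
representatives is again supported outside `P`, so it lies in `K[P]` only if it vanishes, and `K[S]`
is a domain. -/
theorem isPrime_monomialIdeal {P : AddSemigroupIdeal S} (hP : IsPrimeMonoidIdeal P) :
    (monomialIdeal K P).IsPrime := by
  refine ⟨fun h => ?_, fun {f g} hfg => ?_⟩
  · have : single (0 : S) (1 : K) ∈ monomialIdeal K P := h ▸ Submodule.mem_top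
    exact hP.zero_notMem (single_mem_monomialIdeal.1 this)
  have h0 : termsOutside P f * termsOutside P g ∈ monomialIdeal K P := by
    have := Ideal.add_mem _ (Ideal.mul_mem_left _ f (sub_termsOutside_mem (P := P) g))
      (Ideal.mul_mem_left _ (termsOutside P g) (sub_termsOutside_mem (P := P) f))
    convert Ideal.sub_mem _ hfg this using 1
    ring
  have := eq_zero_of_mem_monomialIdeal h0 <| notMem_of_mem_support_mul hP
    (fun _ => notMem_of_mem_support_termsOutside) fun _ => notMem_of_mem_support_termsOutside
  rcases mul_eq_zero.1 this with h | h
  · exact .inl (by simpa [h] using sub_termsOutside_mem (P := P) f)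
  · exact .inr (by simpa [h] using sub_termsOutside_mem (P := P) g)

/-- Minimal non-empty primes of `S` give primes of height one of `K[S]`. -/
theorem height_monomialIdeal {P : AddSemigroupIdeal S} (hP : P ∈ minimalNonemptyPrimes S) :
    (monomialIdeal K P).height = 1 := by
  have := isNoetherianRing_of_fg K S
  obtain ⟨a, ha⟩ := minimalNonemptyPrimes.nonempty hP
  refine Ideal.IsPrime.height_eq_one_of_mem_minimalPrimes (x := single a 1) (by simp)
    ⟨⟨isPrime_monomialIdeal (minimalNonemptyPrimes.isPrime hP), ?_⟩, ?_⟩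
  · rw [Ideal.span_singleton_le_iff_mem]
    exact single_mem_monomialIdeal.2 ha
  · rintro Q ⟨hQ, haQ⟩ hle
    rw [Ideal.span_singleton_le_iff_mem] at haQ
    exact monomialIdeal_le_iff.2 <| minimalNonemptyPrimes.le_of_le hP
      (isPrimeMonoidIdeal_exponentIdeal hQ) ⟨a, haQ⟩
      fun m hm => single_mem_monomialIdeal.1 (hle hm)

/-- Primes of height one of `K[S]` containing a monomial come from minimal non-empty primes. -/
theorem exponentIdeal_mem_minimalNonemptyPrimes {Q : Ideal (AddMonoidAlgebra K S)}
    (hQ : Q.IsPrime) (hht : Q.height = 1) (hne : (exponentIdeal Q : Set S).Nonempty) :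
    exponentIdeal Q ∈ minimalNonemptyPrimes S := by
  refine ⟨⟨isPrimeMonoidIdeal_exponentIdeal hQ, hne⟩, fun P ⟨hP, hPne⟩ hle m hm => ?_⟩
  have : monomialIdeal K P = Q :=
    (isPrime_monomialIdeal hP).eq_of_le_of_height_eq_one (monomialIdeal_ne_bot hPne) hht
      (monomialIdeal_le_iff.2 hle)
  rw [mem_exponentIdeal, ← this] at hm
  exact single_mem_monomialIdeal.1 hm

end MonomialIdeal

end AddMonoidAlgebra

/-! ### Supports of elements of the localization at `K[P]` -/

namespace AddMonoidAlgebra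

variable {K S : Type*} [Field K] [AddCancelCommMonoid S]

/-- If a power of every `m ∈ P` is divisible by `b` up to elements outside of `P`, the same holds
for the elements of `K[P]` and the monomial with exponent `b`. -/
theorem exists_single_mul_pow_eq {P : AddSemigroupIdeal S} (hP : IsPrimeMonoidIdeal P) {b : S}
    (h : ∀ m ∈ P, ∃ (n : ℕ) (t y : S), t ∉ P ∧ n • m + t = b + y)
    {f : AddMonoidAlgebra K S} (hf : f ∈ monomialIdeal K P) :
    ∃ (n : ℕ) (t : S) (d : AddMonoidAlgebra K S), t ∉ P ∧ single t 1 * f ^ n = single b 1 * d := by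
  -- `J` collects the elements divisible by `x^b` once monomials outside `P` are inverted. As its
  -- radical is an ideal, only the monomials of `K[P]` need checking.
  let J : Ideal (AddMonoidAlgebra K S) :=
    { carrier := {d | ∃ t ∉ P, single b 1 ∣ single t (1 : K) * d}
      zero_mem' := ⟨0, hP.zero_notMem, by simp⟩
      add_mem' := by
        rintro d e ⟨t, ht, hd⟩ ⟨u, hu, he⟩
        refine ⟨t + u, by rw [hP.add_mem_iff]; tauto, ?_⟩
        have : single (t + u) (1 : K) = single t 1 * single u 1 := by simp [single_mul_single]
        rw [this, show single t 1 * single u (1 : K) * (d + e) =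
          single u 1 * (single t 1 * d) + single t 1 * (single u 1 * e) by ring]
        exact dvd_add (hd.mul_left _) (he.mul_left _)
      smul_mem' := by
        rintro c d ⟨t, ht, hd⟩
        exact ⟨t, ht, by rw [smul_eq_mul, mul_left_comm]; exact hd.mul_left c⟩ }
  have hle : monomialIdeal K P ≤ J.radical := by
    refine monomialIdeal_le_iff.2 fun m hm => ?_
    obtain ⟨n, t, y, ht, e⟩ := h m hm
    refine ⟨n, t, ht, single y 1, ?_⟩
    rw [single_pow, one_pow, single_mul_single, single_mul_single, add_comm, e]
  obtain ⟨n, t, ht, d, hd⟩ := hle hf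
  exact ⟨n, t, d, ht, hd⟩

/-- Every element of `K[q(S)]` has a monomial denominator. -/
theorem exists_single_mul_eq_mapDomain (f : AddMonoidAlgebra K (GrothendieckAddGroup S)) :
    ∃ (b : S) (d : AddMonoidAlgebra K S),
      mapDomainRingHom K GrothendieckAddGroup.of (single b 1) * f =
        mapDomainRingHom K GrothendieckAddGroup.of d := by
  let := (mapDomainRingHom K (GrothendieckAddGroup.of (M := S))).toAlgebra
  have := isLocalization_mapDomainRingHom (K := K) (GrothendieckAddGroup.of (M := S))
    GrothendieckAddGroup.of_injective GrothendieckAddGroup.exists_eq_of_sub_of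
  obtain ⟨⟨d, ⟨_, b, rfl⟩⟩, hd⟩ := IsLocalization.surj (MonoidHom.mrange (of K S)) f
  exact ⟨b.toAdd, d, (mul_comm _ _).trans hd⟩

variable [IsAddTorsionFree S] [AddMonoid.FG S]

/-- For a minimal non-empty prime `P` of `S`, an element of `K[q(S)]` that lies in the localization
of `K[S]` at `K[P]` is supported in `S_P`. -/
theorem exists_add_eq_of_mem_support {P : AddSemigroupIdeal S} (hP : P ∈ minimalNonemptyPrimes S)
    {f : AddMonoidAlgebra K (GrothendieckAddGroup S)} {s a : AddMonoidAlgebra K S}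
    (hs : s ∉ monomialIdeal K P)
    (h : mapDomainRingHom K GrothendieckAddGroup.of s * f =
      mapDomainRingHom K GrothendieckAddGroup.of a) :
    ∀ g ∈ f.coeff.support, ∃ c, ∃ t ∉ P,
      g + GrothendieckAddGroup.of t = GrothendieckAddGroup.of c := by
  classical
  have hPp := minimalNonemptyPrimes.isPrime hP
  set ι := mapDomainRingHom K (GrothendieckAddGroup.of (M := S)) with hι
  have hιinj : Function.Injective ι := mapDomain_injective GrothendieckAddGroup.of_injective
  obtain ⟨b, d, hd⟩ := exists_single_mul_eq_mapDomain f
  -- Write `s = s₀ + r` with `s₀` the terms outside `P`. Then `s` divides `s₀^n - (-r)^n`, and `x^t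
  -- (-r)^n` is a multiple of `x^b`. Both `s` and `x^b` multiply `f` into `K[S]`, hence so does `x^t
  -- s₀^n`.
  obtain ⟨n, t, e, ht, he⟩ := exists_single_mul_pow_eq hPp
    (fun m hm => exists_nsmul_add_eq_of_mem_minimalNonemptyPrimes hP b hm)
    (neg_mem (sub_termsOutside_mem (P := P) s))
  obtain ⟨c, hc⟩ := sub_dvd_pow_sub_pow (termsOutside P s) (-(s - termsOutside P s)) n
  -- a multiple of `f` by an element supported outside of `P` lies in `K[S]`
  let v := termsOutside P s ^ n * single t 1
  let w := single t 1 * c * a + e * d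
  have hvw : ι v * f = ι w := by
    have hv : v = single t 1 * c * s + single b 1 * e := by
      rw [← he]
      linear_combination single t 1 * hc
    rw [hv, map_add, map_mul, map_mul ι (single b 1), map_add, map_mul _ _ a, map_mul _ e]
    linear_combination ι (single t 1 * c) * h + ι e * hd
  have hvP : ∀ m ∈ v.coeff.support, m ∉ P :=
    notMem_of_mem_support_mul hPp
      (notMem_of_mem_support_pow hPp (fun _ => notMem_of_mem_support_termsOutside) n)
      (fun m hm => by simp at hm; exact hm ▸ ht)
  have hv0 : v ≠ 0 := by
    refine mul_ne_zero (pow_ne_zero _ fun h0 => hs ?_) (by simp)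
    simpa [h0] using sub_termsOutside_mem (P := P) s
  -- `T` describes `S_P`. Multiplying by `v` preserves being supported in `S_P` and being supported
  -- outside it. As `v f` is supported in `S`, the outside part `v f₂` vanishes.
  let T : GrothendieckAddGroup S → Prop := fun g =>
    ∃ c, ∃ t ∉ P, g + GrothendieckAddGroup.of t = GrothendieckAddGroup.of c
  let f₁ : AddMonoidAlgebra K (GrothendieckAddGroup S) := ofCoeff (f.coeff.filter T)
  let f₂ : AddMonoidAlgebra K (GrothendieckAddGroup S) := ofCoeff (f.coeff.filter (¬ T ·))
  have hf : f = f₁ + f₂ := by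
    ext1
    exact (Finsupp.filter_add_filter_not f.coeff T).symm
  have hmem₁ : ∀ g ∈ f₁.coeff.support, T g := fun g hg => by
    rw [coeff_ofCoeff, Finsupp.support_filter, Finset.mem_filter] at hg
    exact hg.2
  have hmem₂ : ∀ g ∈ f₂.coeff.support, ¬ T g := fun g hg => by
    rw [coeff_ofCoeff, Finsupp.support_filter, Finset.mem_filter] at hg
    exact hg.2
  have hzero : ι v * f₂ = 0 := by
    rw [← coeff_eq_zero, ← Finsupp.support_eq_empty, Finset.eq_empty_iff_forall_notMem]
    intro x hx
    have hxT : ¬ T x := by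
      obtain ⟨_, hy', g, hg, rfl⟩ := exists_mem_support_add_of_mem_support_mul hx
      obtain ⟨y, hy, rfl⟩ := exists_mem_support_of_mem_support_mapDomain hy'
      rintro ⟨c, t, ht, e⟩
      refine hmem₂ g hg ⟨c, y + t, ?_, ?_⟩
      · rw [hPp.add_mem_iff]
        exact fun h => h.elim (hvP y hy) ht
      · rw [← e, map_add]
        abel
    have heq : ι v * f₂ = ι w - ι v * f₁ := by
      rw [← hvw, hf]
      ring
    rw [heq, coeff_sub] at hx
    rcases Finset.mem_union.1 (Finsupp.support_sub hx) with hx | hx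
    · obtain ⟨y, -, rfl⟩ := exists_mem_support_of_mem_support_mapDomain hx
      exact hxT ⟨y, 0, hPp.zero_notMem, by simp⟩
    · obtain ⟨_, hy', g, hg, rfl⟩ := exists_mem_support_add_of_mem_support_mul hx
      obtain ⟨y, hy, rfl⟩ := exists_mem_support_of_mem_support_mapDomain hy'
      obtain ⟨c, t, ht, e⟩ := hmem₁ g hg
      exact hxT ⟨y + c, t, ht, by rw [add_assoc, e, map_add]⟩
  have hf₂ : f₂ = 0 :=
    (mul_eq_zero.1 hzero).resolve_left ((map_ne_zero_iff ι hιinj).2 hv0)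
  rw [hf, hf₂, add_zero]
  exact hmem₁

end AddMonoidAlgebra

/-! ### The equivalence -/

open AddMonoidAlgebra in
theorem corollary2p15 (K : Type*) [Field K]
    (S : Type*) [AddCancelCommMonoid S] [IsAddTorsionFree S] [AddMonoid.FG S] :
    IsWeaklyKrullDomain (AddMonoidAlgebra K S) ↔ IsWeaklyKrullMonoid S := by
  let ι := mapDomainRingHom K (GrothendieckAddGroup.of (M := S))
  have hιinj : Function.Injective ι := mapDomain_injective GrothendieckAddGroup.of_injective
  constructor
  · intro hD
    refine ⟨iInf_monoidLocalizationAt_eq_mrange_iff.2 fun g hg => ?_, fun a _ =>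
      (finite_setOf_isPrimeMonoidIdeal S).subset fun P hP => minimalNonemptyPrimes.isPrime hP.1⟩
    obtain ⟨a, b, rfl⟩ := GrothendieckAddGroup.exists_eq_of_sub_of g
    have hdvd := (iInf_domainLocalizationAt_eq_bot_iff _).1 hD.iInf_localization_eq
      (single a (1 : K)) (single b 1) (by simp) fun Q hQ => by
        by_cases hne : (exponentIdeal Q.asIdeal : Set S).Nonempty
        · obtain ⟨c, s, hs, e⟩ := hg _ (exponentIdeal_mem_minimalNonemptyPrimes Q.2 hQ hne)
          refine ⟨single c 1, single s 1, hs, ?_⟩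
          have : a + s = c + b := by
            apply GrothendieckAddGroup.of_injective
            rw [map_add, map_add, ← e]
            abel
          rw [single_mul_single, single_mul_single, this]
        -- `Q` contains no monomial, so `x^b` is already an admissible denominator.
        · exact ⟨single a 1, single b 1, fun h => hne ⟨b, h⟩, rfl⟩
    obtain ⟨z, hz⟩ := hdvd
    have ha : a ∈ (single b (1 : K) * z).coeff.support := by simp [← hz]
    obtain ⟨b', hb', y, -, rfl⟩ := exists_mem_support_add_of_mem_support_mul ha
    obtain rfl : b' = b := by simpa using hb'
    exact ⟨y, by simp⟩
  · intro hS
    have := isNoetherianRing_of_fg K S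
    refine ⟨(iInf_domainLocalizationAt_eq_bot_iff _).2 fun p q hq hloc => ?_, fun x hx _ =>
      finite_heightOneSpectrum_mem _ hx⟩
    have := isNoetherianRing_of_fg K (GrothendieckAddGroup S)
    have := uniqueFactorizationMonoid_of_addCommGroup K (GrothendieckAddGroup S)
    let := ι.toAlgebra
    have := isLocalization_mapDomainRingHom (K := K) (GrothendieckAddGroup.of (M := S))
      GrothendieckAddGroup.of_injective GrothendieckAddGroup.exists_eq_of_sub_of
    obtain ⟨f, hf⟩ : ι q ∣ ι p := IsLocalization.algebraMap_dvd_of_forall_height_eq_one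
      (MonoidHom.mrange (of K S)) hιinj hq hloc
    have hsupp : (f.coeff.support : Set (GrothendieckAddGroup S)) ⊆
        Set.range GrothendieckAddGroup.of := fun g hg => by
      refine iInf_monoidLocalizationAt_eq_mrange_iff.1 hS.iInf_localization_eq g fun P hP => ?_
      obtain ⟨a, s, hs, e⟩ := hloc
        ⟨monomialIdeal K P, isPrime_monomialIdeal (minimalNonemptyPrimes.isPrime hP)⟩
        (height_monomialIdeal hP)
      refine exists_add_eq_of_mem_support (s := s) (a := a) hP hs ?_ g hg
      -- Cancelling `q` from `p s = a q` and `p = q f` leaves `s f = a`.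
      apply mul_left_cancel₀ ((map_ne_zero_iff ι hιinj).2 hq)
      have := congrArg ι e
      rw [map_mul, map_mul, hf] at this
      linear_combination this
    refine ⟨comapDomain _ GrothendieckAddGroup.of_injective f, hιinj ?_⟩
    rw [map_mul, hf]
    congr 1
    exact (mapDomain_comapDomain hsupp _).symm
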